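/- Let $n\ge 1$ and $[n]=\{1,\dots,n\}$, and let $[n]'=\{1',\dots,n'\}$ be a disjoint copy of $[n]$. The partition monoid $\mathcal P_n$ consists of all equivalence relations on $[n]\cup[n]'$; the product $\alpha\beta$ is obtained by stacking $\alpha$ above $\beta$, identifying the lower row of $\alpha$ with the upper row of $\beta$, taking connected components, and deleting the middle row. The Brauer monoid $\mathcal B_n$ is the submonoid of all $\alpha\in\mathcal P_n$ all of whose blocks have exactly two elements. The rank of $\alpha$ is the number of its blocks that meet both $[n]$ and $[n]'$, and $J_r(\mathcal B_n)=\{\alpha\in\mathcal B_n:\operatorname{rank}(\alpha)=r\}$; for $0\le r\le n$ with $r\equiv n \pmod 2$, these sets are exactly the $\mathscr J$-classes of $\mathcal B_n$. The (undirected) Graham--Houghton graph of a $\mathscr J$-class $J$ of a finite regular monoid $M$ is the bipartite graph whose two parts are the set of $\mathscr R$-classes and the set of $\mathscr L$-classes contained in $J$ (where $u\,\mathscr R\,v\Leftrightarrow uM=vM$ and $u\,\mathscr L\,v\Leftrightarrow Mu=Mv$), an $\mathscr R$-class $R$ and an $\mathscr L$-class $L$ being adjacent if and only if $R\cap L$ contains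 an idempotent. An orientation $D$ of a finite simple graph $G$ chooses one of the two directions for each edge. A circuit $C$ (closed path without repeated vertices) of $G$ is central if the graph obtained from $G$ by deleting all vertices of $C$ has a perfect matching (the empty graph has one). A circuit of even length is oddly oriented in $D$ if, for either choice of direction of traversal, the number of its edges that $D$ directs in the direction of traversal is odd. The orientation $D$ is Pfaffian if every central circuit of even length in $G$ is oddly oriented in $D$. **Proposition.** Let $n\ge 3$, and let $\Delta_n$ be the undirected Graham--Houghton graph of the $\mathscr J$-class $J_{n-2}(\mathcal B_n)$ of the Brauer monoid $\mathcal B_n$. Then $\Delta_n$ does not admit a Pfaffian orientation. -/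

import Mathlib

namespace DiagramMonoid

/-! ### The partition monoid and the Brauer monoid -/

/-- An `n`-partition: an equivalence relation on `[n] ∪ [n]'`. The points `Sum.inl i` form the
upper row `[n]`, the points `Sum.inr i` form the lower row `[n]'`. -/
@[ext]
structure PartitionMonoid (n : ℕ) where
  /-- The underlying equivalence relation. -/
  toSetoid : Setoid (Fin n ⊕ Fin n)

variable {n : ℕ}

/-- Embedding of the two rows of a diagram as the upper and middle of three rows. -/
def topMid : Fin n ⊕ Fin n → Fin n ⊕ (Fin n ⊕ Fin n) := Sum.map id Sum.inl

/-- Embedding of the two rows of a diagram as the middle and lower of three rows. -/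
def midBot : Fin n ⊕ Fin n → Fin n ⊕ (Fin n ⊕ Fin n) := Sum.inr

/-- Embedding of the two rows of a diagram as the upper and lower of three rows. -/
def topBot : Fin n ⊕ Fin n → Fin n ⊕ (Fin n ⊕ Fin n) := Sum.map id Sum.inr

/-- The product of `α` and `β`: stack `α` on top of `β`, identifying the lower row of `α` with the
upper row of `β`, take the connected components, and forget the middle row. -/
def PartitionMonoid.mul (α β : PartitionMonoid n) : PartitionMonoid n where
  toSetoid := Setoid.comap topBot (Setoid.map α.toSetoid topMid ⊔ Setoid.map β.toSetoid midBot)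

/-- The identity partition, with blocks `{i, i'}`. -/
def PartitionMonoid.one (n : ℕ) : PartitionMonoid n where
  toSetoid := Setoid.ker (Sum.elim id id)

section aux

variable {A B C X : Type*}

theorem map_le_iff {r : Setoid A} {f : A → B} {s : Setoid B} :
    Setoid.map r f ≤ s ↔ r ≤ Setoid.comap f s := by
  constructor
  · intro h x y hxy
    exact h (Setoid.le_comap_map hxy)
  · intro h
    refine Setoid.eqvGen_le ?_
    rintro _ _ ⟨a, b, hab, rfl, rfl⟩
    exact h hab

theorem map_sup (r s : Setoid A) (f : A → B) :
    Setoid.map (r ⊔ s) f = Setoid.map r f ⊔ Setoid.map s f := by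
  refine eq_of_forall_ge_iff fun t => ?_
  have h : ∀ u : Setoid A, u ≤ Setoid.comap f t ↔ Setoid.map u f ≤ t := fun u => map_le_iff.symm
  rw [sup_le_iff, ← h, ← h, ← h, sup_le_iff]

theorem map_map (r : Setoid A) (f : A → B) (g : B → C) :
    Setoid.map (Setoid.map r f) g = Setoid.map r (g ∘ f) := by
  refine eq_of_forall_ge_iff fun t => ?_
  rw [map_le_iff, map_le_iff, map_le_iff, Setoid.comap_comp]

theorem map_apply (r : Setoid A) {f : A → B} (hf : Function.Injective f) (x y : B) :
    Setoid.map r f x y ↔ (∃ a b, r a b ∧ f a = x ∧ f b = y) ∨ x = y := by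
  have h := Setoid.coe_map_of_ker_le r f (by
    intro a b hab
    rw [hf hab])
  rw [h]
  rfl

theorem comap_sup_map (f : B → X) (R : Setoid X) (S : Setoid B) :
    Setoid.comap f (R ⊔ Setoid.map S f) = Setoid.comap f R ⊔ S := by
  apply le_antisymm
  · set E : Setoid B := Setoid.comap f R ⊔ S with hE
    have h1 : ∀ a b, R (f a) (f b) → E a b := fun a b h =>
      (le_sup_left : Setoid.comap f R ≤ E) h
    let F : Setoid X :=
      { r := fun x y => R x y ∨ ∃ a b, R x (f a) ∧ E a b ∧ R (f b) y
        iseqv :=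
          { refl := fun x => Or.inl (R.refl x)
            symm := by
              rintro x y (h | ⟨a, b, h, h', h''⟩)
              · exact Or.inl (R.symm h)
              · exact Or.inr ⟨b, a, R.symm h'', E.symm h', R.symm h⟩
            trans := by
              rintro x y z (h | ⟨a, b, h, h', h''⟩) (k | ⟨c, d, k, k', k''⟩)
              · exact Or.inl (R.trans h k)
              · exact Or.inr ⟨c, d, R.trans h k, k', k''⟩
              · exact Or.inr ⟨a, b, h, h', R.trans h'' k⟩
              · exact Or.inr ⟨a, d, h, E.trans h' (E.trans (h1 _ _ (R.trans h'' k)) k'), k''⟩ } }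
    have hF : R ⊔ Setoid.map S f ≤ F := by
      refine sup_le (fun {x y} h => Or.inl h) (map_le_iff.2 ?_)
      intro a b h
      exact Or.inr ⟨a, b, R.refl _, (le_sup_right : S ≤ E) h, R.refl _⟩
    intro a b h
    rcases hF h with h | ⟨c, d, h, h', h''⟩
    · exact h1 _ _ h
    · exact E.trans (h1 _ _ h) (E.trans h' (h1 _ _ h''))
  · refine sup_le ?_ (map_le_iff.1 le_sup_right)
    intro a b h
    exact (le_sup_left : R ≤ R ⊔ Setoid.map S f) h

theorem map_comap_square {f : B → X} {g : C → X} {t : A → B} {s : A → C} (W : Setoid C)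
    (hg : Function.Injective g) (ht : Function.Injective t) (hf : Function.Injective f)
    (hsq : ∀ z, f (t z) = g (s z)) (hpb : ∀ x y, f x = g y → ∃ z, x = t z ∧ y = s z) :
    Setoid.map (Setoid.comap s W) t = Setoid.comap f (Setoid.map W g) := by
  ext x y
  rw [Setoid.comap_rel, map_apply _ ht, map_apply _ hg, hf.eq_iff]
  constructor
  · rintro (⟨a, b, h, rfl, rfl⟩ | h)
    · exact Or.inl ⟨s a, s b, h, (hsq a).symm, (hsq b).symm⟩
    · exact Or.inr h
  · rintro (⟨a, b, h, ha, hb⟩ | h)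
    · obtain ⟨z, rfl, rfl⟩ := hpb _ _ ha.symm
      obtain ⟨w, rfl, rfl⟩ := hpb _ _ hb.symm
      exact Or.inl ⟨z, w, h, rfl, rfl⟩
    · exact Or.inr h

/-- In a finite set with two involutions `a`, `b` without common fixed points, the component of a
fixed point of `b` contains exactly one other point fixed by `a` or `b`. -/
theorem dihedral_orbit [Finite X] (a b : Equiv.Perm X) (ha : a * a = 1) (hb : b * b = 1)
    (E : Setoid X) (hEa : ∀ x, E x (a x)) (hEb : ∀ x, E x (b x))
    (hE : ∀ T : Setoid X, (∀ x, T x (a x)) → (∀ x, T x (b x)) → E ≤ T)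
    (hab : ∀ x, ¬ (a x = x ∧ b x = x)) (x : X) (hx : b x = x) :
    ∃ z, z ≠ x ∧ (a z = z ∨ b z = z) ∧ E x z ∧
      ∀ w, E x w → (a w = w ∨ b w = w) → w = x ∨ w = z := by
  set c : Equiv.Perm X := a * b with hc
  have ha' : a⁻¹ = a := inv_eq_of_mul_eq_one_left ha
  have hb' : b⁻¹ = b := inv_eq_of_mul_eq_one_left hb
  have hbc : ∀ k : ℤ, b * c ^ k = c ^ (-k) * b := by
    intro k
    have h1 : b * c * b⁻¹ = c⁻¹ := by
      rw [hc, mul_inv_rev, ha', hb', mul_assoc, mul_assoc, hb, mul_one]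
    have h2 := conj_zpow (a := b) (b := c) (i := k)
    rw [h1, inv_zpow'] at h2
    rw [h2, inv_mul_cancel_right]
  have hac : ∀ k : ℤ, a * c ^ k = c ^ (1 - k) * b := by
    intro k
    have h1 : a = c * b := by rw [hc, mul_assoc, hb, mul_one]
    calc a * c ^ k = c * (b * c ^ k) := by rw [← mul_assoc, ← h1]
      _ = c ^ (1 - k) * b := by rw [hbc, ← mul_assoc, ← zpow_one_add, sub_eq_add_neg]
  have hb_pow : ∀ k : ℤ, b ((c ^ k) x) = (c ^ (-k)) x := by
    intro k
    have := congrArg (fun p : Equiv.Perm X => p x) (hbc k)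
    simpa [hx] using this
  have ha_pow : ∀ k : ℤ, a ((c ^ k) x) = (c ^ (1 - k)) x := by
    intro k
    have := congrArg (fun p : Equiv.Perm X => p x) (hac k)
    simpa only [Equiv.Perm.mul_apply, hx] using this
  have hEc : ∀ y, E y (c y) := fun y => E.trans (hEb y) (hEa (b y))
  have hEpow : ∀ k : ℤ, E x ((c ^ k) x) := by
    have hnat : ∀ (m : ℕ) (y : X), E y ((c ^ m) y) := by
      intro m
      induction m with
      | zero => intro y; exact E.refl y
      | succ m ih =>
        intro y
        rw [pow_succ', Equiv.Perm.mul_apply]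
        exact E.trans (ih y) (hEc _)
    intro k
    obtain ⟨m, rfl | rfl⟩ := k.eq_nat_or_neg
    · rw [zpow_natCast]; exact hnat m x
    · have := hnat m ((c ^ (-(m : ℤ))) x)
      rw [← zpow_natCast, ← Equiv.Perm.mul_apply, ← zpow_add] at this
      simp only [add_neg_cancel, zpow_zero, Equiv.Perm.one_apply] at this
      exact E.symm this
  have hEorb : ∀ w, E x w → ∃ k : ℤ, w = (c ^ k) x := by
    let T : Setoid X := Setoid.ker (fun y => ∃ k : ℤ, y = (c ^ k) x)
    have hT : E ≤ T := by
      refine hE T (fun y => ?_) (fun y => ?_)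
      · refine propext ⟨?_, ?_⟩
        · rintro ⟨k, rfl⟩; exact ⟨1 - k, ha_pow k⟩
        · rintro ⟨k, hk⟩
          refine ⟨1 - k, ?_⟩
          rw [← ha_pow, ← hk, ← Equiv.Perm.mul_apply, ha, Equiv.Perm.one_apply]
      · refine propext ⟨?_, ?_⟩
        · rintro ⟨k, rfl⟩; exact ⟨-k, hb_pow k⟩
        · rintro ⟨k, hk⟩
          refine ⟨-k, ?_⟩
          rw [← hb_pow, ← hk, ← Equiv.Perm.mul_apply, hb, Equiv.Perm.one_apply]
    intro w hw
    have h : (∃ k : ℤ, x = (c ^ k) x) = (∃ k : ℤ, w = (c ^ k) x) := hT hw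
    rw [← h]
    exact ⟨0, rfl⟩
  have hax : a x ≠ x := fun h => hab x ⟨h, hx⟩
  obtain ⟨N, hN0, hN⟩ : ∃ N : ℕ, 0 < N ∧ ∀ k : ℤ, (c ^ k) x = x ↔ (N : ℤ) ∣ k := by
    refine ⟨Function.minimalPeriod (c • ·) x, ?_, fun k => ?_⟩
    · apply Function.minimalPeriod_pos_of_mem_periodicPts
      exact Function.Injective.mem_periodicPts (MulAction.injective c) x
    · exact MulAction.zpow_smul_eq_iff_minimalPeriod_dvd (a := c) (b := x) (n := k)
  have hNeq : ∀ k l : ℤ, (c ^ k) x = (c ^ l) x ↔ (N : ℤ) ∣ k - l := by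
    intro k l
    rw [← hN, sub_eq_neg_add, zpow_add, Equiv.Perm.mul_apply, zpow_neg, Equiv.Perm.inv_eq_iff_eq]
  have hbfix : ∀ k : ℤ, b ((c ^ k) x) = (c ^ k) x ↔ (N : ℤ) ∣ 2 * k := by
    intro k
    rw [hb_pow, hNeq, ← dvd_neg]
    ring_nf
  have hafix : ∀ k : ℤ, a ((c ^ k) x) = (c ^ k) x ↔ (N : ℤ) ∣ 2 * k - 1 := by
    intro k
    rw [ha_pow, hNeq, ← dvd_neg]
    ring_nf
  have key : ∀ q : ℤ, ∀ w, E x w → (a w = w ∨ b w = w) →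
      ((N : ℤ) = 2 * q ∨ (N : ℤ) = 2 * q - 1) → w = x ∨ w = (c ^ q) x := by
    intro q w hw hfix hq
    obtain ⟨k, rfl⟩ := hEorb w hw
    have hx0 : (c ^ k) x = x ↔ (N : ℤ) ∣ k := hN k
    rw [hx0, hNeq]
    rw [hafix, hbfix] at hfix
    rcases hfix with ⟨d, hd⟩ | ⟨d, hd⟩
    · right
      rcases hq with hq | hq
      · exfalso
        rw [hq] at hd
        have : 2 * (k - q * d) = 1 := by linarith
        omega
      · have hodd : d % 2 = 1 := by
          rcases Int.emod_two_eq_zero_or_one d with h | h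
          · exfalso
            obtain ⟨e, rfl⟩ : ∃ e, d = 2 * e := ⟨d / 2, by omega⟩
            have : 2 * (k - (N : ℤ) * e) = 1 := by linarith
            omega
          · exact h
        obtain ⟨e, rfl⟩ : ∃ e, d = 2 * e + 1 := ⟨d / 2, by omega⟩
        exact ⟨e, by linarith⟩
    · rcases Int.emod_two_eq_zero_or_one d with h | h
      · obtain ⟨e, rfl⟩ : ∃ e, d = 2 * e := ⟨d / 2, by omega⟩
        exact Or.inl ⟨e, by linarith⟩
      · obtain ⟨e, rfl⟩ : ∃ e, d = 2 * e + 1 := ⟨d / 2, by omega⟩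
        rcases hq with hq | hq
        · exact Or.inr ⟨e, by linarith⟩
        · exfalso
          rw [hq] at hd
          have : 2 * (k - (2 * q - 1) * e - q) = -1 := by linarith
          omega
  rcases Nat.even_or_odd' N with ⟨q, hq | hq⟩
  · refine ⟨(c ^ (q : ℤ)) x, ?_, Or.inr ?_, hEpow _, fun w hw hfix =>
      key q w hw hfix (Or.inl (by omega))⟩
    · rw [Ne, hN]
      intro h
      have := Int.le_of_dvd (by omega) h
      omega
    · rw [hbfix]
      exact ⟨1, by omega⟩
  · refine ⟨(c ^ ((q : ℤ) + 1)) x, ?_, Or.inl ?_, hEpow _, fun w hw hfix =>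
      key (q + 1) w hw hfix (Or.inr (by omega))⟩
    · rw [Ne, hN]
      intro h
      have h1 := Int.le_of_dvd (by omega) h
      have hq0 : q = 0 := by omega
      subst hq0
      have h2 : (c ^ (1 : ℤ)) x = x := (hN 1).2 (by rw [hq]; simp)
      rw [zpow_one, hc, Equiv.Perm.mul_apply, hx] at h2
      exact hax h2
    · rw [hafix]
      exact ⟨1, by omega⟩

end aux

theorem topMid_injective : Function.Injective (topMid (n := n)) :=
  Sum.map_injective.2 ⟨Function.injective_id, Sum.inl_injective⟩

theorem midBot_injective : Function.Injective (midBot (n := n)) := Sum.inr_injective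

theorem topBot_injective : Function.Injective (topBot (n := n)) :=
  Sum.map_injective.2 ⟨Function.injective_id, Sum.inr_injective⟩

theorem PartitionMonoid.mul_assoc' (α β γ : PartitionMonoid n) :
    (α.mul β).mul γ = α.mul (β.mul γ) := by
  let f134 : Fin n ⊕ (Fin n ⊕ Fin n) → Fin n ⊕ (Fin n ⊕ (Fin n ⊕ Fin n)) := Sum.map id Sum.inr
  let f123 : Fin n ⊕ (Fin n ⊕ Fin n) → Fin n ⊕ (Fin n ⊕ (Fin n ⊕ Fin n)) := Sum.map id (Sum.map id Sum.inl)
  let f124 : Fin n ⊕ (Fin n ⊕ Fin n) → Fin n ⊕ (Fin n ⊕ (Fin n ⊕ Fin n)) := Sum.map id (Sum.map id Sum.inr)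
  let f234 : Fin n ⊕ (Fin n ⊕ Fin n) → Fin n ⊕ (Fin n ⊕ (Fin n ⊕ Fin n)) := Sum.inr
  have i134 : Function.Injective f134 :=
    Sum.map_injective.2 ⟨Function.injective_id, Sum.inr_injective⟩
  have i123 : Function.Injective f123 := Sum.map_injective.2 ⟨Function.injective_id,
    Sum.map_injective.2 ⟨Function.injective_id, Sum.inl_injective⟩⟩
  have i124 : Function.Injective f124 := Sum.map_injective.2 ⟨Function.injective_id,
    Sum.map_injective.2 ⟨Function.injective_id, Sum.inr_injective⟩⟩
  have i234 : Function.Injective f234 := Sum.inr_injective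
  have hL : ((α.mul β).mul γ).toSetoid = Setoid.comap (f134 ∘ topBot)
      (Setoid.map α.toSetoid (f123 ∘ topMid) ⊔ Setoid.map β.toSetoid (f123 ∘ midBot) ⊔
        Setoid.map γ.toSetoid (f134 ∘ midBot)) := by
    change Setoid.comap topBot (Setoid.map (Setoid.comap topBot
      (Setoid.map α.toSetoid topMid ⊔ Setoid.map β.toSetoid midBot)) topMid ⊔
        Setoid.map γ.toSetoid midBot) = _
    rw [map_comap_square (f := f134) (g := f123) _ i123 topMid_injective i134
      (by rintro (z | z) <;> rfl)
      (by
        rintro (x | x | x) (y | y | y) h <;>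
          simp only [f134, f123, Sum.map_inl, Sum.map_inr, Sum.inl.injEq, Sum.inr.injEq,
            reduceCtorEq, id_eq] at h
        · subst h; exact ⟨Sum.inl x, rfl, rfl⟩
        · subst h; exact ⟨Sum.inr x, rfl, rfl⟩),
      ← comap_sup_map, map_map, map_sup, map_map, map_map, Setoid.comap_comp]
  have hR : (α.mul (β.mul γ)).toSetoid = Setoid.comap (f124 ∘ topBot)
      (Setoid.map β.toSetoid (f234 ∘ topMid) ⊔ Setoid.map γ.toSetoid (f234 ∘ midBot) ⊔
        Setoid.map α.toSetoid (f124 ∘ topMid)) := by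
    change Setoid.comap topBot (Setoid.map α.toSetoid topMid ⊔ Setoid.map (Setoid.comap topBot
      (Setoid.map β.toSetoid topMid ⊔ Setoid.map γ.toSetoid midBot)) midBot) = _
    rw [map_comap_square (f := f124) (g := f234) _ i234 midBot_injective i124
      (by rintro (z | z) <;> rfl)
      (by
        rintro (x | x | x) (y | y | y) h <;>
          simp only [f124, f234, Sum.map_inl, Sum.map_inr, Sum.inl.injEq, Sum.inr.injEq,
            reduceCtorEq, id_eq] at h
        · subst h; exact ⟨Sum.inl x, rfl, rfl⟩
        · subst h; exact ⟨Sum.inr x, rfl, rfl⟩),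
      sup_comm, ← comap_sup_map, map_map, map_sup, map_map, map_map, Setoid.comap_comp]
  have e0 : f134 ∘ topBot = f124 ∘ topBot := by funext x; rcases x with x | x <;> rfl
  have e1 : f123 ∘ topMid = f124 ∘ topMid := by funext x; rcases x with x | x <;> rfl
  have e2 : f123 ∘ midBot = f234 ∘ topMid := by funext x; rcases x with x | x <;> rfl
  have e3 : f134 ∘ midBot = f234 ∘ midBot := by funext x; rcases x with x | x <;> rfl
  apply PartitionMonoid.ext
  rw [hL, hR, e0, e1, e2, e3, sup_assoc, sup_comm]

theorem PartitionMonoid.mul_one' (α : PartitionMonoid n) :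
    α.mul (PartitionMonoid.one n) = α := by
  apply PartitionMonoid.ext
  apply le_antisymm
  · let p : Fin n ⊕ (Fin n ⊕ Fin n) → Fin n ⊕ Fin n := Sum.map id (Sum.elim id id)
    have h : Setoid.map α.toSetoid topMid ⊔ Setoid.map (PartitionMonoid.one n).toSetoid midBot ≤
        Setoid.comap p α.toSetoid := by
      refine sup_le (map_le_iff.2 ?_) (map_le_iff.2 ?_)
      · rintro (x | x) (y | y) h <;> exact h
      · rintro (x | x) (y | y) h <;> (obtain rfl : x = y := h; exact Setoid.refl' _ _)
    rintro (x | x) (y | y) hxy <;> exact h hxy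
  · set E := Setoid.map α.toSetoid topMid ⊔ Setoid.map (PartitionMonoid.one n).toSetoid midBot with hE
    have h1 : ∀ x, E (topBot x) (topMid x) := by
      rintro (x | x)
      · exact E.refl _
      · exact (map_le_iff.1 (le_sup_right : _ ≤ E)) (x := Sum.inr x) (y := Sum.inl x) rfl
    intro x y h
    exact E.trans (h1 x) (E.trans ((map_le_iff.1 (le_sup_left : _ ≤ E)) h) (E.symm (h1 y)))

theorem PartitionMonoid.one_mul' (α : PartitionMonoid n) :
    (PartitionMonoid.one n).mul α = α := by
  apply PartitionMonoid.ext
  apply le_antisymm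
  · let p : Fin n ⊕ (Fin n ⊕ Fin n) → Fin n ⊕ Fin n := Sum.elim Sum.inl id
    have h : Setoid.map (PartitionMonoid.one n).toSetoid topMid ⊔ Setoid.map α.toSetoid midBot ≤
        Setoid.comap p α.toSetoid := by
      refine sup_le (map_le_iff.2 ?_) (map_le_iff.2 ?_)
      · rintro (x | x) (y | y) h <;> (obtain rfl : x = y := h; exact Setoid.refl' _ _)
      · rintro (x | x) (y | y) h <;> exact h
    rintro (x | x) (y | y) hxy <;> exact h hxy
  · set E := Setoid.map (PartitionMonoid.one n).toSetoid topMid ⊔ Setoid.map α.toSetoid midBot with hE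
    have h1 : ∀ x, E (topBot x) (midBot x) := by
      rintro (x | x)
      · exact (map_le_iff.1 (le_sup_left : _ ≤ E)) (x := Sum.inl x) (y := Sum.inr x) rfl
      · exact E.refl _
    intro x y h
    exact E.trans (h1 x) (E.trans ((map_le_iff.1 (le_sup_right : _ ≤ E)) h) (E.symm (h1 y)))

instance (n : ℕ) : Monoid (PartitionMonoid n) where
  mul := PartitionMonoid.mul
  one := PartitionMonoid.one n
  mul_assoc := PartitionMonoid.mul_assoc'
  one_mul := PartitionMonoid.one_mul'
  mul_one := PartitionMonoid.mul_one'

/-- `α.Rel x y` says that `x` and `y` lie in the same block of `α`. -/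
def PartitionMonoid.Rel (α : PartitionMonoid n) (x y : Fin n ⊕ Fin n) : Prop :=
  α.toSetoid x y

/-- The set of blocks of `α`. -/
def PartitionMonoid.blocks (α : PartitionMonoid n) : Set (Set (Fin n ⊕ Fin n)) :=
  α.toSetoid.classes

/-- The rank of `α`: the number of its transversal blocks, that is, of the blocks that meet both
rows. -/
noncomputable def PartitionMonoid.rank (α : PartitionMonoid n) : ℕ :=
  {b ∈ α.blocks | (∃ i, Sum.inl i ∈ b) ∧ ∃ j, Sum.inr j ∈ b}.ncard

/-- `α` is a Brauer diagram: every block has exactly two elements. -/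
def PartitionMonoid.IsBrauer (α : PartitionMonoid n) : Prop := ∀ b ∈ α.blocks, b.ncard = 2

theorem isBrauer_iff (α : PartitionMonoid n) : α.IsBrauer ↔
    ∃ p : Fin n ⊕ Fin n → Fin n ⊕ Fin n, ∀ x, p x ≠ x ∧ ∀ y, α.Rel x y ↔ y = x ∨ y = p x := by
  constructor
  · intro h
    have h2 : ∀ x, ∃ z, z ≠ x ∧ ∀ y, α.Rel x y ↔ y = x ∨ y = z := by
      intro x
      have hx := h {y | α.Rel y x} (Setoid.mem_classes α.toSetoid x)
      obtain ⟨u, v, huv, hs⟩ := Set.ncard_eq_two.1 hx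
      have hmem : ∀ y, α.Rel x y ↔ y = u ∨ y = v := by
        intro y
        have : y ∈ {y | α.Rel y x} ↔ y ∈ ({u, v} : Set _) := by rw [hs]
        exact ⟨fun hxy => this.1 (Setoid.symm' α.toSetoid hxy), fun hxy => Setoid.symm' α.toSetoid (this.2 hxy)⟩
      rcases (hmem x).1 (Setoid.refl' α.toSetoid x) with rfl | rfl
      · exact ⟨v, huv.symm, hmem⟩
      · exact ⟨u, huv, fun y => (hmem y).trans or_comm⟩
    choose p hp using h2
    exact ⟨p, hp⟩
  · rintro ⟨p, hp⟩ b ⟨x, rfl⟩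
    have : {y | α.Rel y x} = {x, p x} := by
      ext y
      exact ⟨fun h => ((hp x).2 y).1 (Setoid.symm' α.toSetoid h),
        fun h => Setoid.symm' α.toSetoid (((hp x).2 y).2 h)⟩
    change Set.ncard {y | α.Rel y x} = 2
    rw [this, Set.ncard_pair (hp x).1.symm]

theorem partner_invol {α : PartitionMonoid n} {p : Fin n ⊕ Fin n → Fin n ⊕ Fin n}
    (hp : ∀ x, p x ≠ x ∧ ∀ y, α.Rel x y ↔ y = x ∨ y = p x) (x : Fin n ⊕ Fin n) :
    p (p x) = x := by
  have h1 : α.Rel x (p x) := ((hp x).2 _).2 (Or.inr rfl)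
  rcases ((hp (p x)).2 x).1 (Setoid.symm' α.toSetoid h1) with h | h
  · exact absurd h.symm (hp x).1
  · exact h.symm

theorem isBrauer_one : (1 : PartitionMonoid n).IsBrauer := by
  refine (isBrauer_iff _).2 ⟨Sum.swap, ?_⟩
  rintro (x | x)
  · refine ⟨Sum.inr_ne_inl, ?_⟩
    rintro (y | y)
    · change x = y ↔ _
      simp [eq_comm]
    · change x = y ↔ _
      simp [eq_comm]
  · refine ⟨Sum.inl_ne_inr, ?_⟩
    rintro (y | y)
    · change x = y ↔ _
      simp [eq_comm]
    · change x = y ↔ _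
      simp [eq_comm]

theorem isBrauer_mul {α β : PartitionMonoid n} (hα : α.IsBrauer) (hβ : β.IsBrauer) :
    (α * β).IsBrauer := by
  obtain ⟨p, hp⟩ := (isBrauer_iff α).1 hα
  obtain ⟨q, hq⟩ := (isBrauer_iff β).1 hβ
  have hpi := partner_invol hp
  have hqi := partner_invol hq
  let a' : Fin n ⊕ (Fin n ⊕ Fin n) → Fin n ⊕ (Fin n ⊕ Fin n) :=
    Sum.elim (fun i => topMid (p (Sum.inl i)))
      (Sum.elim (fun i => topMid (p (Sum.inr i))) (fun i => Sum.inr (Sum.inr i)))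
  let b' : Fin n ⊕ (Fin n ⊕ Fin n) → Fin n ⊕ (Fin n ⊕ Fin n) :=
    Sum.elim Sum.inl (fun z => midBot (q z))
  have a_tm : ∀ z, a' (topMid z) = topMid (p z) := by rintro (z | z) <;> rfl
  have b_mb : ∀ z, b' (midBot z) = midBot (q z) := fun z => rfl
  have ha' : Function.Involutive a' := by
    rintro (x | x | x)
    · change a' (topMid (p (Sum.inl x))) = _
      rw [a_tm, hpi]; rfl
    · change a' (topMid (p (Sum.inr x))) = _
      rw [a_tm, hpi]; rfl
    · rfl
  have hb' : Function.Involutive b' := by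
    rintro (x | x)
    · rfl
    · change b' (midBot (q x)) = _
      rw [b_mb, hqi]; rfl
  let a : Equiv.Perm _ := ha'.toPerm
  let b : Equiv.Perm _ := hb'.toPerm
  have ha : a * a = 1 := Equiv.ext ha'
  have hb : b * b = 1 := Equiv.ext hb'
  have a_fix_tm : ∀ z, a (topMid z) ≠ topMid z := fun z h =>
    (hp z).1 (topMid_injective ((a_tm z).symm.trans h))
  have b_fix_mb : ∀ z, b (midBot z) ≠ midBot z := fun z h =>
    (hq z).1 (midBot_injective h)
  set E : Setoid (Fin n ⊕ (Fin n ⊕ Fin n)) := Setoid.map α.toSetoid topMid ⊔ Setoid.map β.toSetoid midBot with hEdef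
  have hEa : ∀ x, E x (a x) := by
    have h : ∀ z, E (topMid z) (a (topMid z)) := by
      intro z
      have := map_le_iff.1 (le_sup_left : _ ≤ E) (((hp z).2 (p z)).2 (Or.inr rfl))
      change E (topMid z) (a' (topMid z))
      rw [a_tm]
      exact this
    rintro (x | x | x)
    · exact h (Sum.inl x)
    · exact h (Sum.inr x)
    · exact E.refl _
  have hEb : ∀ x, E x (b x) := by
    rintro (x | x)
    · exact E.refl _
    · exact map_le_iff.1 (le_sup_right : _ ≤ E) (((hq x).2 (q x)).2 (Or.inr rfl))
  have hE : ∀ T : Setoid (Fin n ⊕ (Fin n ⊕ Fin n)),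
      (∀ x, T x (a x)) → (∀ x, T x (b x)) → E ≤ T := by
    intro T hTa hTb
    refine sup_le (map_le_iff.2 ?_) (map_le_iff.2 ?_)
    · intro x y hxy
      rcases ((hp x).2 y).1 hxy with rfl | rfl
      · exact T.refl _
      · have := hTa (topMid x)
        change T (topMid x) (a' (topMid x)) at this
        rw [a_tm] at this
        exact this
    · intro x y hxy
      rcases ((hq x).2 y).1 hxy with rfl | rfl
      · exact T.refl _
      · exact hTb (midBot x)
  have hab : ∀ x, ¬ (a x = x ∧ b x = x) := by
    rintro (x | x | x) ⟨h1, h2⟩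
    · exact a_fix_tm (Sum.inl x) h1
    · exact a_fix_tm (Sum.inr x) h1
    · exact b_fix_mb (Sum.inr x) h2
  have houter : ∀ x, (a x = x ∨ b x = x) ↔ ∃ z, x = topBot z := by
    rintro (x | x | x)
    · exact ⟨fun _ => ⟨Sum.inl x, rfl⟩, fun _ => Or.inr rfl⟩
    · constructor
      · rintro (h | h)
        · exact absurd h (a_fix_tm (Sum.inr x))
        · exact absurd h (b_fix_mb (Sum.inl x))
      · rintro ⟨z | z, h⟩ <;> simp [topBot] at h
    · exact ⟨fun _ => ⟨Sum.inr x, rfl⟩, fun _ => Or.inl rfl⟩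
  have main : ∀ x : Fin n ⊕ Fin n, ∃ z, z ≠ topBot x ∧ (a z = z ∨ b z = z) ∧ E (topBot x) z ∧
      ∀ w, E (topBot x) w → (a w = w ∨ b w = w) → w = topBot x ∨ w = z := by
    rintro (x | x)
    · exact dihedral_orbit a b ha hb E hEa hEb hE hab _ rfl
    · obtain ⟨z, h1, h2, h3, h4⟩ := dihedral_orbit b a hb ha E hEb hEa
        (fun T h1 h2 => hE T h2 h1) (fun x h => hab x h.symm) (topBot (Sum.inr x)) rfl
      exact ⟨z, h1, h2.symm, h3, fun w hw hw' => h4 w hw hw'.symm⟩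
  rw [isBrauer_iff]
  have fin : ∀ x, ∃ z, z ≠ x ∧ ∀ y, (α * β).Rel x y ↔ y = x ∨ y = z := by
    intro x
    obtain ⟨z, h1, h2, h3, h4⟩ := main x
    obtain ⟨z, rfl⟩ := (houter z).1 h2
    refine ⟨z, fun h => h1 (by rw [h]), fun y => ?_⟩
    change E (topBot x) (topBot y) ↔ _
    constructor
    · intro h
      rcases h4 _ h ((houter _).2 ⟨y, rfl⟩) with h | h
      · exact Or.inl (topBot_injective h)
      · exact Or.inr (topBot_injective h)
    · rintro (rfl | rfl)
      · exact E.refl _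
      · exact h3
  choose r hr using fin
  exact ⟨r, hr⟩

/-- The Brauer monoid `B_n`, as a submonoid of the partition monoid. -/
def brauerMonoid (n : ℕ) : Submonoid (PartitionMonoid n) where
  carrier := {α | α.IsBrauer}
  mul_mem' := isBrauer_mul
  one_mem' := isBrauer_one

/-- `J_r(B_n)`, the set of all elements of rank `r` of the Brauer monoid. -/
def brauerJ (n r : ℕ) : Set (brauerMonoid n) := {α | (α : PartitionMonoid n).rank = r}

/-! ### Green's relations and Graham–Houghton graphs -/

/-- Green's relation `R` on a monoid: `u R v` if and only if `uM = vM`. -/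
def greenR (M : Type*) [Monoid M] : Setoid M := Setoid.ker fun u => Set.range fun s : M => u * s

/-- Green's relation `L` on a monoid: `u L v` if and only if `Mu = Mv`. -/
def greenL (M : Type*) [Monoid M] : Setoid M := Setoid.ker fun u => Set.range fun s : M => s * u

/-- The set of `R`-classes of a monoid that meet the subset `J` (for a `J`-class: those contained
in it), each represented by its intersection with `J`. -/
abbrev RClasses {M : Type*} [Monoid M] (J : Set M) : Type _ :=
  Quotient ((greenR M).comap ((↑) : J → M))

/-- The set of `L`-classes of a monoid that meet the subset `J` (for a `J`-class: those contained
in it), each represented by its intersection with `J`. -/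
abbrev LClasses {M : Type*} [Monoid M] (J : Set M) : Type _ :=
  Quotient ((greenL M).comap ((↑) : J → M))

/-- The (undirected) Graham–Houghton graph of a `J`-class `J`: the bipartite graph whose two parts
are the sets of `R`-classes and of `L`-classes in `J`, where an `R`-class and an `L`-class are
adjacent if and only if their intersection contains an idempotent. -/
def grahamHoughtonGraph {M : Type*} [Monoid M] (J : Set M) :
    SimpleGraph (RClasses J ⊕ LClasses J) :=
  SimpleGraph.fromRel fun v w =>
    ∃ e : J, IsIdempotentElem (e : M) ∧
      v = Sum.inl (Quotient.mk ((greenR M).comap ((↑) : J → M)) e) ∧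
      w = Sum.inr (Quotient.mk ((greenL M).comap ((↑) : J → M)) e)

/-! ### Pfaffian orientations -/

/-- An orientation of a simple graph: every edge receives exactly one of its two directions;
`D.Arc u v` says that there is an edge between `u` and `v`, directed from `u` to `v`. -/
structure GraphOrientation {V : Type*} (G : SimpleGraph V) where
  /-- The arcs of the orientation. -/
  Arc : V → V → Prop
  adj_of_arc : ∀ {u v}, Arc u v → G.Adj u v
  xor_arc : ∀ {u v}, G.Adj u v → Xor (Arc u v) (Arc v u)

namespace GraphOrientation

variable {V : Type*} {G : SimpleGraph V}

open Classical in
/-- The number of edges of the walk `c` that are directed in the direction of traversal. -/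
noncomputable def forwardCount (D : GraphOrientation G) {u v : V} (c : G.Walk u v) : ℕ :=
  c.darts.countP fun d => decide (D.Arc d.fst d.snd)

/-- A circuit is oddly oriented if for either choice of direction of traversal, the number of its
edges directed in the direction of traversal is odd. -/
def OddlyOriented (D : GraphOrientation G) {u : V} (c : G.Walk u u) : Prop :=
  Odd (D.forwardCount c) ∧ Odd (D.forwardCount c.reverse)

end GraphOrientation

/-- A circuit is central if the graph obtained by deleting its vertices has a perfect matching. -/
def IsCentral {V : Type*} {G : SimpleGraph V} {u : V} (c : G.Walk u u) : Prop :=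
  ∃ M : (G.induce {v | v ∉ c.support}).Subgraph, M.IsPerfectMatching

/-- An orientation is Pfaffian if every even central circuit is oddly oriented. -/
def GraphOrientation.IsPfaffian {V : Type*} {G : SimpleGraph V} (D : GraphOrientation G) : Prop :=
  ∀ (u : V) (c : G.Walk u u), c.IsCycle → Even c.length → IsCentral c → D.OddlyOriented c

end DiagramMonoid

/-! The obstruction is a copy of `K_{3,3}` whose complement has a perfect matching. Write `α*` for
`α` with its rows exchanged. Since `α α* α = α`, the element `α α*` is an idempotent in the R-class
of `α` and the L-class of `α*`, and it has the rank of `α`. Hence matching the R-class of `α` with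
the L-class of `α*` is a perfect matching `τ` of the whole graph (`adj_vertexFlip`,
`vertexFlip_flip`).

For `i, j` in `{0, 1, 2}` let `e i j` be the diagram `hook n i j`, of rank `n - 2`. These satisfy `e
i j * e k l = e i l` and `(e i j)* = e j i`. So every `e i j` is idempotent, and the R-classes of
the `e i i` together with the L-classes of the `e j j` span a `K_{3,3}` that `τ` maps to itself.

By `not_isPfaffian_of_involution` this excludes a Pfaffian orientation. A 4-circuit in the `K_{3,3}`
leaves one edge of it, and `τ` matches all remaining vertices, so the circuit is central. The three
4-circuits through two fixed R-classes cover every edge they use exactly twice. Modulo 2 the sum of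
their forward counts is therefore 0, whereas three odd numbers have an odd sum. -/

namespace DiagramMonoid

/-! ### Pfaffian orientations and a matched `K_{3,3}`. -/

section Pfaffian

variable {V : Type*} {G : SimpleGraph V}

/-- A fixed-point-free involution along edges of a set of vertices is a perfect matching of the
induced subgraph. -/
theorem exists_isPerfectMatching_induce (S : Set V) (f : V → V)
    (hS : ∀ v ∈ S, f v ∈ S) (hf : ∀ v ∈ S, f (f v) = v) (hadj : ∀ v ∈ S, G.Adj v (f v)) :
    ∃ M : (G.induce S).Subgraph, M.IsPerfectMatching := by
  refine ⟨{ verts := Set.univ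
            Adj := fun v w => f v = w
            adj_sub := ?_
            edge_vert := fun _ => Set.mem_univ _
            symm := ?_ }, ?_, fun _ => Set.mem_univ _⟩
  · rintro ⟨v, hv⟩ ⟨w, hw⟩ (rfl : f v = w)
    exact hadj v hv
  · refine ⟨?_⟩
    rintro ⟨v, hv⟩ ⟨w, hw⟩ (rfl : f v = w)
    exact hf v hv
  · rintro ⟨v, hv⟩ -
    exact ⟨⟨f v, hS v hv⟩, rfl, fun w hw => Subtype.ext (Eq.symm hw)⟩

/-- The circuit `u, v, w, x, u`. -/
def squareWalk {u v w x : V} (h₁ : G.Adj u v) (h₂ : G.Adj v w) (h₃ : G.Adj w x)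
    (h₄ : G.Adj x u) : G.Walk u u :=
  .cons h₁ (.cons h₂ (.cons h₃ (.cons h₄ .nil)))

theorem squareWalk_isCycle {u v w x : V} (h₁ : G.Adj u v) (h₂ : G.Adj v w) (h₃ : G.Adj w x)
    (h₄ : G.Adj x u) (huw : u ≠ w) (hvx : v ≠ x) : (squareWalk h₁ h₂ h₃ h₄).IsCycle := by
  have := h₁.ne
  have := h₂.ne
  have := h₃.ne
  have := h₄.ne
  rw [squareWalk, SimpleGraph.Walk.cons_isCycle_iff]
  constructor
  · simp [SimpleGraph.Walk.isPath_def]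
    grind
  · simp
    grind

theorem mem_support_squareWalk {u v w x : V} (h₁ : G.Adj u v) (h₂ : G.Adj v w) (h₃ : G.Adj w x)
    (h₄ : G.Adj x u) (y : V) :
    y ∈ (squareWalk h₁ h₂ h₃ h₄).support ↔ y = u ∨ y = v ∨ y = w ∨ y = x := by
  simp [squareWalk]
  grind

open Classical in
theorem forwardCount_squareWalk (D : GraphOrientation G) {u v w x : V} (h₁ : G.Adj u v)
    (h₂ : G.Adj v w) (h₃ : G.Adj w x) (h₄ : G.Adj x u) :
    D.forwardCount (squareWalk h₁ h₂ h₃ h₄) =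
      (if D.Arc u v then 1 else 0) + (if D.Arc v w then 1 else 0) +
      (if D.Arc w x then 1 else 0) + (if D.Arc x u then 1 else 0) := by
  simp [squareWalk, GraphOrientation.forwardCount, List.countP_cons]
  ring

open Classical in
/-- A graph with a perfect matching that contains a `K_{3,3}` saturated by the matching has no
Pfaffian orientation. -/
theorem not_isPfaffian_of_involution (D : GraphOrientation G) (τ : V → V)
    (hτ : ∀ v, τ (τ v) = v) (hadj : ∀ v, G.Adj v (τ v)) (a : Fin 3 → V)
    (ha : Function.Injective a) (hab : ∀ i j, G.Adj (a i) (τ (a j))) : ¬ D.IsPfaffian := by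
  intro hD
  have hne : ∀ i j, a i ≠ τ (a j) := fun i j => (hab i j).ne
  have hτi : ∀ {v w}, τ v = τ w → v = w := fun {v w} h => by rw [← hτ v, h, hτ]
  -- The circuit runs through `a 0`, `τ (a j)`, `a 1`, `τ (a k)`; the index `l` is the one left
  -- over, so that `a 2` and `τ (a l)` are the vertices of the `K_{3,3}` off the circuit.
  have key : ∀ j k l : Fin 3, j ≠ k → j ≠ l → k ≠ l →
      Odd ((if D.Arc (a 0) (τ (a j)) then 1 else 0) + (if D.Arc (τ (a j)) (a 1) then 1 else 0) +
      (if D.Arc (a 1) (τ (a k)) then 1 else 0) + (if D.Arc (τ (a k)) (a 0) then 1 else 0)) := by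
    intro j k l hjk hjl hkl
    have h3 : ∀ m : Fin 3, m = j ∨ m = k ∨ m = l := by omega
    rw [← forwardCount_squareWalk D (hab 0 j) (hab 1 j).symm (hab 1 k) (hab 0 k).symm]
    refine (hD _ _ (squareWalk_isCycle _ _ _ _ (fun h => by simpa using ha h)
      (fun h => hjk (ha (hτi h)))) (by simp [squareWalk]; decide) ?_).1
    have h01 : ∀ m : Fin 3, m = 0 ∨ m = 1 ∨ m = 2 := by omega
    have hmem : ∀ v, v ∈ {v | v ∉ (squareWalk (hab 0 j) (hab 1 j).symm (hab 1 k)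
        (hab 0 k).symm).support} ↔ v ≠ a 0 ∧ v ≠ τ (a j) ∧ v ≠ a 1 ∧ v ≠ τ (a k) := by
      intro v
      rw [Set.mem_ofPred_eq, mem_support_squareWalk]
      tauto
    have h20 : a 2 ≠ a 0 := fun h => by simpa using ha h
    have h21 : a 2 ≠ a 1 := fun h => by simpa using ha h
    have hlj : τ (a l) ≠ τ (a j) := fun h => hjl (ha (hτi h)).symm
    have hlk : τ (a l) ≠ τ (a k) := fun h => hkl (ha (hτi h)).symm
    -- The six excluded vertices form a `τ`-invariant set, so `τ` also preserves its complement.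
    have hout : ∀ v, v ≠ a 2 → v ≠ τ (a l) → v ≠ a 0 → v ≠ τ (a j) → v ≠ a 1 → v ≠ τ (a k) →
        ∀ m, τ v ≠ a m ∧ τ v ≠ τ (a m) := by
      intro v h1 h2 h3' h4 h5 h6 m
      constructor
      · intro h
        have h' : v = τ (a m) := by rw [← h, hτ]
        rcases h3 m with rfl | rfl | rfl <;> contradiction
      · intro h
        have h' := hτi h
        rcases h01 m with rfl | rfl | rfl <;> contradiction
    -- Off the circuit, `τ` is kept except that `a 2` is matched with `τ (a l)`: their partners
    -- under `τ` may have been deleted.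
    refine exists_isPerfectMatching_induce _
      (fun v => if v = a 2 then τ (a l) else if v = τ (a l) then a 2 else τ v) ?_ ?_ ?_
    · intro v hv
      rw [hmem] at hv ⊢
      obtain ⟨h1, h2, h3', h4⟩ := hv
      by_cases e1 : v = a 2
      · simp only [e1, if_true]
        exact ⟨(hne _ _).symm, hlj, (hne _ _).symm, hlk⟩
      by_cases e2 : v = τ (a l)
      · simp only [if_false, e2, if_true, (hne 2 l).symm]
        exact ⟨h20, hne _ _, h21, hne _ _⟩
      · simp only [e1, e2, if_false]
        have := hout v e1 e2 h1 h2 h3' h4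
        exact ⟨(this _).1, (this _).2, (this _).1, (this _).2⟩
    · intro v hv
      rw [hmem] at hv
      obtain ⟨h1, h2, h3', h4⟩ := hv
      by_cases e1 : v = a 2
      · simp [e1, (hne 2 l).symm]
      by_cases e2 : v = τ (a l)
      · simp [e2, (hne 2 l).symm]
      · have := hout v e1 e2 h1 h2 h3' h4
        simp [e1, e2, (this 2).1, (this l).2, hτ]
    · intro v hv
      rw [hmem] at hv
      by_cases e1 : v = a 2
      · simp only [e1, if_true]
        exact hab _ _
      by_cases e2 : v = τ (a l)
      · simp only [if_false, e2, if_true, (hne 2 l).symm]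
        exact (hab _ _).symm
      · simp only [e1, e2, if_false]
        exact hadj v
  have k1 := key 0 1 2 (by decide) (by decide) (by decide)
  have k2 := key 1 2 0 (by decide) (by decide) (by decide)
  have k3 := key 0 2 1 (by decide) (by decide) (by decide)
  -- With `x i j` the indicator of an arc from `a i` to `τ (a j)`, each count becomes `x 0 j + x 1 j
  -- + x 0 k + x 1 k` modulo 2. Every `x i j` then occurs in two of the three odd counts, and all
  -- truth values are contradictory.
  have hx : ∀ i j, (if D.Arc (τ (a j)) (a i) then 1 else 0) =
      1 - (if D.Arc (a i) (τ (a j)) then 1 else 0) := by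
    intro i j
    rcases D.xor_arc (hab i j) with h | h <;> simp [h.1, h.2]
  simp only [hx, Nat.odd_iff] at k1 k2 k3
  split_ifs at k1 k2 k3

end Pfaffian

/-! ### Row exchange, rank, and the hook diagrams. -/

section Star

variable {n : ℕ}

namespace PartitionMonoid

/-- The diagram obtained by exchanging the two rows. -/
def flip (α : PartitionMonoid n) : PartitionMonoid n where
  toSetoid := Setoid.comap Sum.swap α.toSetoid

theorem flip_flip (α : PartitionMonoid n) : α.flip.flip = α := by
  apply PartitionMonoid.ext
  ext x y
  change α.toSetoid x.swap.swap y.swap.swap ↔ _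
  rw [Sum.swap_swap, Sum.swap_swap]

/-- A relation on three rows compatible with both factors bounds their product. -/
theorem mul_rel_of_le {α β : PartitionMonoid n} (T : Setoid (Fin n ⊕ (Fin n ⊕ Fin n)))
    (hα : ∀ x y, α.Rel x y → T (topMid x) (topMid y))
    (hβ : ∀ x y, β.Rel x y → T (midBot x) (midBot y)) {x y : Fin n ⊕ Fin n}
    (h : (α * β).Rel x y) : T (topBot x) (topBot y) := by
  have : Setoid.map α.toSetoid topMid ⊔ Setoid.map β.toSetoid midBot ≤ T :=
    sup_le (map_le_iff.2 fun {x y} h => hα x y h) (map_le_iff.2 fun {x y} h => hβ x y h)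
  exact this h

theorem mul_rel_left {α β : PartitionMonoid n} {i j : Fin n}
    (h : α.Rel (Sum.inl i) (Sum.inl j)) : (α * β).Rel (Sum.inl i) (Sum.inl j) :=
  map_le_iff.1 (le_sup_left :
    _ ≤ Setoid.map α.toSetoid topMid ⊔ Setoid.map β.toSetoid midBot) h

/-- Blocks of size two leave no room for a proper refinement. Identities between products of Brauer
diagrams thus need only one inclusion, the one that `mul_rel_of_le` provides. -/
theorem IsBrauer.eq_of_rel {α β : PartitionMonoid n} (hα : α.IsBrauer) (hβ : β.IsBrauer)
    (h : ∀ x y, α.Rel x y → β.Rel x y) : α = β := by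
  obtain ⟨p, hp⟩ := (isBrauer_iff α).1 hα
  obtain ⟨q, hq⟩ := (isBrauer_iff β).1 hβ
  have hpq : ∀ x, p x = q x := fun x =>
    (((hq x).2 _).1 (h _ _ (((hp x).2 _).2 (Or.inr rfl)))).resolve_left (hp x).1
  apply PartitionMonoid.ext
  ext x y
  change α.Rel x y ↔ β.Rel x y
  rw [(hp x).2, (hq x).2, hpq]

theorem IsBrauer.flip {α : PartitionMonoid n} (hα : α.IsBrauer) : α.flip.IsBrauer := by
  obtain ⟨p, hp⟩ := (isBrauer_iff α).1 hα
  refine (isBrauer_iff _).2 ⟨fun x => (p x.swap).swap, fun x => ⟨fun h => ?_, fun y => ?_⟩⟩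
  · apply (hp x.swap).1
    conv_rhs => rw [← h]
    exact (Sum.swap_swap _).symm
  · change α.Rel x.swap y.swap ↔ _
    rw [(hp _).2, Sum.swap_leftInverse.injective.eq_iff,
      ← Sum.swap_leftInverse.injective.eq_iff (a := y) (b := (p x.swap).swap), Sum.swap_swap]

theorem IsBrauer.flip_mul {α β : PartitionMonoid n} (hα : α.IsBrauer) (hβ : β.IsBrauer) :
    (α * β).flip = β.flip * α.flip := by
  refine (isBrauer_mul hα hβ).flip.eq_of_rel (isBrauer_mul hβ.flip hα.flip) fun x y h => ?_
  set E := Setoid.map β.flip.toSetoid topMid ⊔ Setoid.map α.flip.toSetoid midBot with hE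
  -- `f` turns the three-row picture upside down.
  let f : Fin n ⊕ (Fin n ⊕ Fin n) → Fin n ⊕ (Fin n ⊕ Fin n) :=
    Sum.elim (fun i => Sum.inr (Sum.inr i))
      (Sum.elim (fun i => Sum.inr (Sum.inl i)) (fun i => Sum.inl i))
  have h1 : ∀ z, f (topMid z) = midBot z.swap := by rintro (z | z) <;> rfl
  have h2 : ∀ z, f (midBot z) = topMid z.swap := by rintro (z | z) <;> rfl
  have h3 : ∀ z : Fin n ⊕ Fin n, f (topBot z.swap) = topBot z := by rintro (z | z) <;> rfl
  have := mul_rel_of_le (α := α) (β := β) (Setoid.comap f E) (fun x y hxy => ?_)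
    (fun x y hxy => ?_) h
  · rw [Setoid.comap_rel, h3, h3] at this
    exact this
  · rw [Setoid.comap_rel, h1, h1]
    refine map_le_iff.1 (le_sup_right : _ ≤ E) ?_
    change α.Rel _ _
    simpa using hxy
  · rw [Setoid.comap_rel, h2, h2]
    refine map_le_iff.1 (le_sup_left : _ ≤ E) ?_
    change β.Rel _ _
    simpa using hxy

/-- The stacked diagram folds onto `α`: reflecting the copy of `α.flip` back identifies all layers
with `α`, so related points of the product are related in `α`. -/
theorem IsBrauer.mul_flip_mul {α : PartitionMonoid n} (hα : α.IsBrauer) :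
    α * α.flip * α = α := by
  refine (isBrauer_mul (isBrauer_mul hα hα.flip) hα).eq_of_rel hα fun x y h => ?_
  -- The first fold sends both outer rows of `α * α.flip` to the upper row of `α` and the middle row
  -- to the lower one.
  have h1 : ∀ x y, (α * α.flip).Rel x y →
      α.Rel (Sum.elim Sum.inl Sum.inl x) (Sum.elim Sum.inl Sum.inl y) := by
    intro x y h
    have := mul_rel_of_le (Setoid.comap (Sum.elim Sum.inl (Sum.elim Sum.inr Sum.inl)) α.toSetoid)
      ?_ ?_ h
    · rcases x with x | x <;> rcases y with y | y <;> exact this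
    · rintro (x | x) (y | y) h <;> exact h
    · rintro (x | x) (y | y) h <;> exact h
  have := mul_rel_of_le (Setoid.comap (Sum.elim Sum.inl (Sum.elim Sum.inl Sum.inr)) α.toSetoid)
      ?_ ?_ h
  · rcases x with x | x <;> rcases y with y | y <;> exact this
  · intro x y h
    have := h1 x y h
    rcases x with x | x <;> rcases y with y | y <;> exact this
  · rintro (x | x) (y | y) h <;> exact h

theorem rank_flip (α : PartitionMonoid n) : α.flip.rank = α.rank := by
  have hinj : Function.Injective (Set.image (Sum.swap : Fin n ⊕ Fin n → Fin n ⊕ Fin n)) :=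
    Set.image_injective.2 Sum.swap_leftInverse.injective
  rw [rank, rank]
  symm
  rw [← Set.ncard_image_of_injective _ hinj]
  refine congrArg Set.ncard (Eq.symm ?_)
  have hflip : ∀ (β : PartitionMonoid n) (b : Set (Fin n ⊕ Fin n)), b ∈ β.blocks →
      Sum.swap '' b ∈ β.flip.blocks := by
    rintro β _ ⟨x, rfl⟩
    refine ⟨x.swap, ?_⟩
    ext y
    change _ ↔ β.toSetoid y.swap x.swap.swap
    rw [Sum.swap_swap]
    constructor
    · rintro ⟨z, hz, rfl⟩
      rw [Sum.swap_swap]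
      exact hz
    · intro h
      exact ⟨y.swap, h, Sum.swap_swap _⟩
  ext b
  constructor
  · rintro ⟨hb, ⟨i, hi⟩, j, hj⟩
    refine ⟨Sum.swap '' b, ⟨?_, ⟨j, _, hj, rfl⟩, i, _, hi, rfl⟩, ?_⟩
    · have := hflip _ _ hb
      rwa [flip_flip] at this
    · rw [← Set.image_comp]
      simp
  · rintro ⟨b, ⟨hb, ⟨i, hi⟩, j, hj⟩, rfl⟩
    exact ⟨hflip _ _ hb, ⟨j, _, hj, rfl⟩, i, _, hi, rfl⟩

/-- A transversal block of the product has an upper point whose `α`-block is transversal. This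
choice is injective, because `α`-related upper points stay related in the product. -/
theorem rank_mul_le_left (α β : PartitionMonoid n) : (α * β).rank ≤ α.rank := by
  classical
  have h : ∀ b ∈ {b ∈ (α * β).blocks | (∃ i, Sum.inl i ∈ b) ∧ ∃ j, Sum.inr j ∈ b},
      ∃ i : Fin n, b = {y | (α * β).Rel y (Sum.inl i)} ∧
        ∃ j, α.Rel (Sum.inr j) (Sum.inl i) := by
    rintro _ ⟨⟨x, rfl⟩, ⟨i, hi⟩, j, hj⟩
    refine ⟨i, ?_, ?_⟩
    · ext y
      exact ⟨fun h => Setoid.trans' (α * β).toSetoid h (Setoid.symm' _ hi),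
        fun h => Setoid.trans' (α * β).toSetoid h hi⟩
    · by_contra! hcon
      have hij : (α * β).Rel (Sum.inr j) (Sum.inl i) := Setoid.trans' _ hj (Setoid.symm' _ hi)
      -- `P` marks the `α`-block of `i`. If that block misses the middle row, `P` is constant on
      -- connected components, so the component of `i` cannot reach the bottom row.
      let P : Fin n ⊕ (Fin n ⊕ Fin n) → Prop :=
        Sum.elim (fun k => α.Rel (Sum.inl k) (Sum.inl i)) (fun _ => False)
      have hP : ∀ z, P (topMid z) ↔ α.Rel z (Sum.inl i) := by
        rintro (z | z)
        · exact Iff.rfl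
        · exact ⟨False.elim, fun h => hcon z h⟩
      have : P (topBot (Sum.inr j)) = P (topBot (Sum.inl i)) :=
        mul_rel_of_le (α := α) (β := β) (Setoid.ker P) (fun x y hxy => by
          change P _ = P _
          rw [eq_iff_iff, hP, hP]
          exact ⟨fun h => Setoid.trans' _ (Setoid.symm' _ hxy) h, fun h => Setoid.trans' _ hxy h⟩)
          (fun x y hxy => rfl) hij
      have hfalse : False := by
        change False = α.Rel (Sum.inl i) (Sum.inl i) at this
        rw [this]
        exact Setoid.refl' _ _
      exact hfalse
  -- `choose!` needs a default point of `Fin n`; without one there are no transversal blocks.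
  rcases isEmpty_or_nonempty (Fin n) with hn | hn
  · rw [rank, Set.eq_empty_of_forall_notMem fun b hb => hn.elim (h b hb).choose, Set.ncard_empty]
    exact Nat.zero_le _
  choose! f hf1 hf2 using h
  refine Set.ncard_le_ncard_of_injOn (fun b => {y | α.Rel y (Sum.inl (f b))}) ?_ ?_
    (Set.toFinite _)
  · intro b hb
    exact ⟨Setoid.mem_classes _ _, ⟨f b, Setoid.refl' _ _⟩, hf2 b hb⟩
  · intro b hb c hc hbc
    have h1 : α.Rel (Sum.inl (f b)) (Sum.inl (f c)) := by
      have : Sum.inl (f b) ∈ {y | α.Rel y (Sum.inl (f b))} := Setoid.refl' _ _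
      simp only at hbc
      rwa [hbc] at this
    have h2 := mul_rel_left (β := β) h1
    rw [hf1 b hb, hf1 c hc]
    ext y
    exact ⟨fun h => Setoid.trans' (α * β).toSetoid h h2,
      fun h => Setoid.trans' (α * β).toSetoid h (Setoid.symm' _ h2)⟩

theorem IsBrauer.rank_mul_flip {α : PartitionMonoid n} (hα : α.IsBrauer) :
    (α * α.flip).rank = α.rank := by
  refine le_antisymm (rank_mul_le_left _ _) ?_
  conv_lhs => rw [← hα.mul_flip_mul]
  exact rank_mul_le_left _ _

/-! ### Diagrams with a hook inside `{0, 1, 2}` -/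

/-- Block labels of the diagram that joins `i` to `j'`, the two other points of `{0, 1, 2}` in
each row to each other, and `k` to `k'` for `k ≥ 3`. -/
def hookLabel (i j : ℕ) : Fin n ⊕ Fin n → ℕ :=
  -- Label 0 is the line from `i` to `j'`, label 1 the upper hook, label 2 the lower hook.
  Sum.elim (fun x => if 3 ≤ x.1 then x.1 else if x.1 = i then 0 else 1)
    (fun x => if 3 ≤ x.1 then x.1 else if x.1 = j then 0 else 2)

/-- The diagram that joins `i` to `j'`, the two other points of `{0, 1, 2}` in each row to each
other, and `k` to `k'` for `k ≥ 3`. -/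
def hook (n i j : ℕ) : PartitionMonoid n where
  toSetoid := Setoid.ker (hookLabel i j)

theorem hook_rel {i j : ℕ} {x y : Fin n ⊕ Fin n} :
    (hook n i j).Rel x y ↔ hookLabel i j x = hookLabel i j y := Iff.rfl

theorem isBrauer_hook (hn : 3 ≤ n) {i j : ℕ} (hi : i < 3) (hj : j < 3) :
    (hook n i j).IsBrauer := by
  have h : ∀ x, ∃ z, z ≠ x ∧ ∀ y, (hook n i j).Rel x y ↔ y = x ∨ y = z := by
    rintro (x | x)
    · by_cases hx : 3 ≤ x.1
      · refine ⟨Sum.inr x, by simp, ?_⟩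
        rintro (y | y) <;> simp [hook_rel, hookLabel, Fin.ext_iff] <;> grind
      by_cases hxi : x.1 = i
      · refine ⟨Sum.inr ⟨j, by omega⟩, by simp, ?_⟩
        rintro (y | y) <;> simp [hook_rel, hookLabel, Fin.ext_iff] <;> grind
      -- Since `0 + 1 + 2 = 3`, this is the third point of `{0, 1, 2}`.
      · refine ⟨Sum.inl ⟨3 - i - x.1, by omega⟩, by simp [Fin.ext_iff]; omega, ?_⟩
        rintro (y | y) <;> simp [hook_rel, hookLabel, Fin.ext_iff] <;> grind
    · by_cases hx : 3 ≤ x.1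
      · refine ⟨Sum.inl x, by simp, ?_⟩
        rintro (y | y) <;> simp [hook_rel, hookLabel, Fin.ext_iff] <;> grind
      by_cases hxj : x.1 = j
      · refine ⟨Sum.inl ⟨i, by omega⟩, by simp, ?_⟩
        rintro (y | y) <;> simp [hook_rel, hookLabel, Fin.ext_iff] <;> grind
      · refine ⟨Sum.inr ⟨3 - j - x.1, by omega⟩, by simp [Fin.ext_iff]; omega, ?_⟩
        rintro (y | y) <;> simp [hook_rel, hookLabel, Fin.ext_iff] <;> grind
  choose p hp using h
  exact (isBrauer_iff _).2 ⟨p, hp⟩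

theorem hook_mul_hook (hn : 3 ≤ n) {i j k l : ℕ} (hi : i < 3) (hj : j < 3) (hk : k < 3)
    (hl : l < 3) : hook n i j * hook n k l = hook n i l := by
  refine (isBrauer_mul (isBrauer_hook hn hi hj) (isBrauer_hook hn hk hl)).eq_of_rel
    (isBrauer_hook hn hi hl) fun x y h => ?_
  -- For `j ≠ k` the two middle hooks link `j` to `k` through the third point; for `j = k` they
  -- close into a loop, which disappears. Giving all three middle points label 0 bounds the
  -- components in both cases.
  let g : Fin n ⊕ (Fin n ⊕ Fin n) → ℕ :=
    Sum.elim (fun x => hookLabel i l (Sum.inl x))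
      (Sum.elim (fun x => if 3 ≤ x.1 then x.1 else 0) (fun x => hookLabel i l (Sum.inr x)))
  have := mul_rel_of_le (Setoid.ker g) ?_ ?_ h
  · rw [hook_rel]
    rcases x with x | x <;> rcases y with y | y <;> exact this
  · intro x y
    rw [hook_rel, Setoid.ker_def]
    rcases x with x | x <;> rcases y with y | y <;> 
      simp only [g, hookLabel, topMid, Sum.map_inl, Sum.map_inr, id_eq, Sum.elim_inl,
        Sum.elim_inr] <;>
      split_ifs <;> intro h <;> omega
  · intro x y
    rw [hook_rel, Setoid.ker_def]
    rcases x with x | x <;> rcases y with y | y <;> 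
      simp only [g, hookLabel, midBot, Sum.elim_inl,
        Sum.elim_inr] <;>
      split_ifs <;> intro h <;> omega

theorem flip_hook (hn : 3 ≤ n) {i j : ℕ} (hi : i < 3) (hj : j < 3) :
    (hook n i j).flip = hook n j i := by
  refine (isBrauer_hook hn hi hj).flip.eq_of_rel (isBrauer_hook hn hj hi) fun x y h => ?_
  change hookLabel i j x.swap = hookLabel i j y.swap at h
  rw [hook_rel]
  rcases x with x | x <;> rcases y with y | y <;> simp [hookLabel] at h ⊢ <;>
      split_ifs at h ⊢ <;> omega

theorem rank_hook (hn : 3 ≤ n) {i j : ℕ} (hi : i < 3) (hj : j < 3) :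
    (hook n i j).rank = n - 2 := by
  -- The labels of transversal blocks are 0 and `3, ..., n - 1`.
  have hcard : (insert 0 (Finset.Ico 3 n)).card = n - 2 := by
    rw [Finset.card_insert_of_notMem (by simp), Nat.card_Ico]
    omega
  let B : ℕ → Set (Fin n ⊕ Fin n) := fun m => {y | hookLabel i j y = m}
  have hset : {b ∈ (hook n i j).blocks | (∃ i, Sum.inl i ∈ b) ∧ ∃ j, Sum.inr j ∈ b} =
      B '' (insert 0 (Finset.Ico 3 n) : Finset ℕ) := by
    ext b
    constructor
    · rintro ⟨⟨x, rfl⟩, ⟨k, hk⟩, l, hl⟩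
      refine ⟨hookLabel i j x, ?_, rfl⟩
      change hookLabel i j _ = hookLabel i j x at hk hl
      rw [← hl] at hk ⊢
      simp [hookLabel] at hk ⊢
      have := k.2
      have := l.2
      split_ifs at hk ⊢ <;> omega
    · rintro ⟨m, hm, rfl⟩
      have hm' : m = 0 ∨ 3 ≤ m ∧ m < n := by simpa using hm
      rcases hm' with rfl | ⟨h3, hmn⟩
      · have h1 : hookLabel i j (Sum.inl (⟨i, by omega⟩ : Fin n)) = 0 := by
          simp [hookLabel]; omega
        have h2 : hookLabel i j (Sum.inr (⟨j, by omega⟩ : Fin n)) = 0 := by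
          simp [hookLabel]; omega
        refine ⟨⟨Sum.inl ⟨i, by omega⟩, ?_⟩, ⟨_, h1⟩, _, h2⟩
        ext y
        change _ = _ ↔ _ = _
        rw [h1]
      · have h1 : hookLabel i j (Sum.inl (⟨m, by omega⟩ : Fin n)) = m := by
          simp [hookLabel]; omega
        have h2 : hookLabel i j (Sum.inr (⟨m, by omega⟩ : Fin n)) = m := by
          simp [hookLabel]; omega
        refine ⟨⟨Sum.inl ⟨m, by omega⟩, ?_⟩, ⟨_, h1⟩, _, h2⟩
        ext y
        change _ = _ ↔ _ = _
        rw [h1]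
  rw [rank, hset, Set.InjOn.ncard_image, Set.ncard_coe_finset, hcard]
  intro m hm m' hm' h
  have hx : ∃ y : Fin n ⊕ Fin n, hookLabel i j y = m := by
    have hm'' : m = 0 ∨ 3 ≤ m ∧ m < n := by simpa using hm
    rcases hm'' with rfl | ⟨h3, hmn⟩
    · exact ⟨Sum.inl ⟨i, by omega⟩, by simp [hookLabel]; omega⟩
    · exact ⟨Sum.inl ⟨m, by omega⟩, by simp [hookLabel]; omega⟩
  obtain ⟨y, hy⟩ := hx
  have : y ∈ B m' := h ▸ hy
  exact hy.symm.trans this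

/-- The upper hook survives right multiplication and contains `k`, whereas in `hook n k l` the point
`k` lies on a transversal. This separates the three R-classes of the `K_{3,3}`. -/
theorem hook_mul_ne {i k : ℕ} (hn : 3 ≤ n) (hi : i < 3) (hk : k < 3) (hik : i ≠ k) (j l : ℕ)
    (s : PartitionMonoid n) : hook n i j * s ≠ hook n k l := by
  intro h
  have h1 : (hook n i j).Rel (Sum.inl ⟨k, by omega⟩) (Sum.inl ⟨3 - i - k, by omega⟩) := by
    simp [hook_rel, hookLabel]
    split_ifs <;> omega
  have h2 := mul_rel_left (β := s) h1
  rw [h, hook_rel] at h2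
  simp [hookLabel] at h2
  split_ifs at h2 <;> omega

end PartitionMonoid

/-- The anti-involution of the Brauer monoid exchanging the two rows. -/
def brauerFlip (α : brauerMonoid n) : brauerMonoid n :=
  ⟨(α : PartitionMonoid n).flip, PartitionMonoid.IsBrauer.flip α.2⟩

theorem brauerFlip_flip (α : brauerMonoid n) : brauerFlip (brauerFlip α) = α :=
  Subtype.ext (PartitionMonoid.flip_flip _)

theorem brauerFlip_mul (α β : brauerMonoid n) :
    brauerFlip (α * β) = brauerFlip β * brauerFlip α :=
  Subtype.ext (PartitionMonoid.IsBrauer.flip_mul α.2 β.2)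

theorem mul_brauerFlip_mul (α : brauerMonoid n) : α * brauerFlip α * α = α :=
  Subtype.ext (PartitionMonoid.IsBrauer.mul_flip_mul α.2)

end Star

/-! ### Green's relations and adjacency through representatives. -/

section Green

variable {M : Type*} [Monoid M]

theorem greenR_iff {u v : M} : greenR M u v ↔ (∃ s, u = v * s) ∧ ∃ s, v = u * s := by
  change (Set.range fun s : M => u * s) = (Set.range fun s : M => v * s) ↔ _
  constructor
  · intro h
    have h1 : u ∈ Set.range fun s : M => v * s := h ▸ ⟨1, mul_one u⟩
    have h2 : v ∈ Set.range fun s : M => u * s := h ▸ ⟨1, mul_one v⟩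
    exact ⟨h1.imp fun _ => Eq.symm, h2.imp fun _ => Eq.symm⟩
  · rintro ⟨⟨s, hs⟩, t, ht⟩
    apply Set.Subset.antisymm
    · rintro _ ⟨r, rfl⟩
      exact ⟨s * r, by simp only [← mul_assoc, ← hs]⟩
    · rintro _ ⟨r, rfl⟩
      exact ⟨t * r, by simp only [← mul_assoc, ← ht]⟩

theorem greenL_iff {u v : M} : greenL M u v ↔ (∃ s, u = s * v) ∧ ∃ s, v = s * u := by
  change (Set.range fun s : M => s * u) = (Set.range fun s : M => s * v) ↔ _
  constructor
  · intro h
    have h1 : u ∈ Set.range fun s : M => s * v := h ▸ ⟨1, one_mul u⟩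
    have h2 : v ∈ Set.range fun s : M => s * u := h ▸ ⟨1, one_mul v⟩
    exact ⟨h1.imp fun _ => Eq.symm, h2.imp fun _ => Eq.symm⟩
  · rintro ⟨⟨s, hs⟩, t, ht⟩
    apply Set.Subset.antisymm
    · rintro _ ⟨r, rfl⟩
      exact ⟨r * s, by simp only [mul_assoc, ← hs]⟩
    · rintro _ ⟨r, rfl⟩
      exact ⟨r * t, by simp only [mul_assoc, ← ht]⟩

theorem grahamHoughtonGraph_adj {J : Set M} {u v : J} (e : J) (he : IsIdempotentElem (e : M))
    (hu : greenR M u e) (hv : greenL M v e) :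
    (grahamHoughtonGraph J).Adj (Sum.inl (Quotient.mk _ u)) (Sum.inr (Quotient.mk _ v)) := by
  refine (SimpleGraph.fromRel_adj _ _ _).2 ⟨Sum.inl_ne_inr, Or.inl ⟨e, he, ?_, ?_⟩⟩
  · exact congrArg Sum.inl (Quotient.sound hu)
  · exact congrArg Sum.inr (Quotient.sound hv)

end Green

/-! ### The perfect matching by row exchange, and the hooks as elements of rank `n - 2`. -/

section Brauer

variable {n r : ℕ}

theorem greenL_brauerFlip {α β : brauerMonoid n} (h : greenR _ α β) :
    greenL _ (brauerFlip α) (brauerFlip β) := by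
  obtain ⟨⟨s, hs⟩, t, ht⟩ := greenR_iff.1 h
  exact greenL_iff.2 ⟨⟨brauerFlip s, by rw [← brauerFlip_mul, ← hs]⟩,
    brauerFlip t, by rw [← brauerFlip_mul, ← ht]⟩

theorem greenR_brauerFlip {α β : brauerMonoid n} (h : greenL _ α β) :
    greenR _ (brauerFlip α) (brauerFlip β) := by
  obtain ⟨⟨s, hs⟩, t, ht⟩ := greenL_iff.1 h
  exact greenR_iff.2 ⟨⟨brauerFlip s, by rw [← brauerFlip_mul, ← hs]⟩,
    brauerFlip t, by rw [← brauerFlip_mul, ← ht]⟩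

/-- Exchanging rows, on the set of diagrams of a given rank. -/
def brauerJFlip (α : brauerJ n r) : brauerJ n r :=
  ⟨brauerFlip α, (PartitionMonoid.rank_flip _).trans α.2⟩

/-- Exchanging rows, on the vertices of the Graham–Houghton graph. -/
def vertexFlip : RClasses (brauerJ n r) ⊕ LClasses (brauerJ n r) →
    RClasses (brauerJ n r) ⊕ LClasses (brauerJ n r) :=
  Sum.elim
    (fun v => Sum.inr (Quotient.map brauerJFlip (fun _ _ h => greenL_brauerFlip h) v))
    (fun v => Sum.inl (Quotient.map brauerJFlip (fun _ _ h => greenR_brauerFlip h) v))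

theorem brauerJFlip_flip (α : brauerJ n r) : brauerJFlip (brauerJFlip α) = α :=
  Subtype.ext (brauerFlip_flip _)

theorem vertexFlip_flip (v : RClasses (brauerJ n r) ⊕ LClasses (brauerJ n r)) :
    vertexFlip (vertexFlip v) = v := by
  rcases v with ⟨⟨α⟩⟩ | ⟨⟨α⟩⟩
  · exact congrArg (fun β => Sum.inl (Quotient.mk _ β)) (brauerJFlip_flip α)
  · exact congrArg (fun β => Sum.inr (Quotient.mk _ β)) (brauerJFlip_flip α)

/-- The idempotent that witnesses the edge is `α * brauerFlip α`. -/
theorem adj_vertexFlip_inl (α : brauerJ n r) :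
    (grahamHoughtonGraph (brauerJ n r)).Adj (Sum.inl (Quotient.mk _ α))
      (Sum.inr (Quotient.mk _ (brauerJFlip α))) := by
  have hmem : α.1 * brauerFlip α.1 ∈ brauerJ n r := by
    change (α.1.1 * α.1.1.flip).rank = r
    rw [PartitionMonoid.IsBrauer.rank_mul_flip α.1.2]
    exact α.2
  refine grahamHoughtonGraph_adj ⟨_, hmem⟩ ?_ ?_ ?_
  · change α.1 * brauerFlip α.1 * (α.1 * brauerFlip α.1) = α * brauerFlip α.1
    rw [← mul_assoc, mul_brauerFlip_mul]
  · exact greenR_iff.2 ⟨⟨α.1, (mul_brauerFlip_mul _).symm⟩, brauerFlip α.1, rfl⟩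
  · refine greenL_iff.2 ⟨⟨brauerFlip α.1, ?_⟩, α.1, rfl⟩
    change brauerFlip α.1 = brauerFlip α.1 * (α.1 * brauerFlip α.1)
    have := mul_brauerFlip_mul (brauerFlip α.1)
    rw [brauerFlip_flip, mul_assoc] at this
    exact this.symm

theorem adj_vertexFlip (v : RClasses (brauerJ n r) ⊕ LClasses (brauerJ n r)) :
    (grahamHoughtonGraph (brauerJ n r)).Adj v (vertexFlip v) := by
  rcases v with ⟨⟨α⟩⟩ | ⟨⟨α⟩⟩
  · exact adj_vertexFlip_inl α
  · have := (adj_vertexFlip_inl (brauerJFlip α)).symm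
    rw [brauerJFlip_flip] at this
    exact this

/-- The hook diagrams as elements of rank `n - 2` of the Brauer monoid. -/
def brauerHook (hn : 3 ≤ n) (i j : Fin 3) : brauerJ n (n - 2) :=
  ⟨⟨PartitionMonoid.hook n i j, PartitionMonoid.isBrauer_hook hn i.2 j.2⟩,
    PartitionMonoid.rank_hook hn i.2 j.2⟩

theorem brauerHook_mul (hn : 3 ≤ n) (i j k l : Fin 3) :
    (brauerHook hn i j : brauerMonoid n) * brauerHook hn k l = brauerHook hn i l :=
  Subtype.ext (PartitionMonoid.hook_mul_hook hn i.2 j.2 k.2 l.2)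

theorem brauerJFlip_hook (hn : 3 ≤ n) (i j : Fin 3) :
    brauerJFlip (brauerHook hn i j) = brauerHook hn j i :=
  Subtype.ext (Subtype.ext (PartitionMonoid.flip_hook hn i.2 j.2))

end Brauer

end DiagramMonoid

/-! ### Assembly: the hooks form a matched `K_{3,3}`. -/

open DiagramMonoid in
theorem mainTheorem10 (n : ℕ) (hn : 3 ≤ n) :
    ¬ ∃ D : DiagramMonoid.GraphOrientation
        (DiagramMonoid.grahamHoughtonGraph (DiagramMonoid.brauerJ n (n - 2))),
      D.IsPfaffian := by
  rintro ⟨D, hD⟩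
  refine not_isPfaffian_of_involution D vertexFlip vertexFlip_flip adj_vertexFlip
    (fun i => Sum.inl (Quotient.mk _ (brauerHook hn i i))) ?_ ?_ hD
  · intro i k h
    by_contra hik
    have h1 : greenR _ (brauerHook hn k k : brauerMonoid n) (brauerHook hn i i) :=
      Quotient.exact (s := (greenR _).comap ((↑) : brauerJ n (n - 2) → brauerMonoid n))
         (Sum.inl_injective h.symm)
    obtain ⟨⟨s, hs⟩, -⟩ := greenR_iff.1 h1
    exact PartitionMonoid.hook_mul_ne hn i.2 k.2 (fun h => hik (Fin.ext h)) i k s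
      (congrArg Subtype.val hs).symm
  · intro i j
    -- Row exchange fixes `brauerHook hn j j`, so the target is its L-class; the idempotent
    -- `brauerHook hn i j` lies in that L-class and in the R-class of `brauerHook hn i i`.
    change (grahamHoughtonGraph _).Adj _ (Sum.inr (Quotient.mk _ (brauerJFlip (brauerHook hn j j))))
    rw [brauerJFlip_hook]
    refine grahamHoughtonGraph_adj (brauerHook hn i j) (brauerHook_mul hn i j i j) ?_ ?_
    · exact greenR_iff.2 ⟨⟨_, (brauerHook_mul hn i j i i).symm⟩, _, (brauerHook_mul hn i i i j).symm⟩
    · exact greenL_iff.2 ⟨⟨_, (brauerHook_mul hn j j i j).symm⟩, _, (brauerHook_mul hn i j j j).symm⟩
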